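/- Let $\mathbb{U}=\{z\in\mathbb{C}:|z|<1\}$ and let $H^2$ be the Hardy space of $\mathbb{U}$, that is, the Hilbert space of all analytic functions $f(z)=\sum_{n\ge 0}a_nz^n$ on $\mathbb{U}$ with $\|f\|^2=\sum_{n\ge 0}|a_n|^2<\infty$. For a bounded analytic function $\varphi$ on $\mathbb{U}$ let $T_\varphi:H^2\to H^2$, $T_\varphi f=\varphi f$, be the analytic Toeplitz operator with symbol $\varphi$. A complex number $\lambda$ is called an extended eigenvalue of a bounded operator $T$ on $H^2$ if there is a bounded linear operator $X\neq 0$ on $H^2$ such that $X(\lambda T)=TX$. Proposition 7.1 (extended eigenvalues of $T_{z^2+z}$). Let $\varphi(z)=z^2+z$. Then the set of extended eigenvalues of $T_\varphi$ is $$\{1\}\cup\bigl(\mathbb{C}\setminus(-4\varphi(\mathbb{U}))\bigr),\qquad\text{where } -4\varphi(\mathbb{U})=\{-4(z^2+z): z\in\mathbb{U}\}.$$ -/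

import Mathlib

open Metric
open scoped Complex.UnitDisc ENNReal

noncomputable section

/-! ### Intertwining and extended eigenvalues of bounded operators -/

/-- `A ∝ B`: there is a nonzero bounded operator `X` with `X A = B X`. -/
def Intertwined {E : Type*} [NormedAddCommGroup E] [NormedSpace ℂ E] (A B : E →L[ℂ] E) : Prop :=
  ∃ X : E →L[ℂ] E, X ≠ 0 ∧ X ∘L A = B ∘L X

/-- The set of extended eigenvalues of `T`: the complex numbers `l` with `l T ∝ T`. -/
def extendedEigenvalues {E : Type*} [NormedAddCommGroup E] [NormedSpace ℂ E] (T : E →L[ℂ] E) :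
    Set ℂ :=
  {l : ℂ | Intertwined (l • T) T}

/-! ### The Hardy space `H²` of the unit disc -/

/-- The complex vector space (under pointwise operations) of the functions on the unit disc that are
the sum of a power series with square-summable coefficients. -/
def hardySubmodule : Submodule ℂ (𝔻 → ℂ) where
  carrier := {f | ∃ a : lp (fun _ : ℕ => ℂ) 2, ∀ z : 𝔻, HasSum (fun n => a n * (z : ℂ) ^ n) (f z)}
  add_mem' := by
    rintro f g ⟨a, ha⟩ ⟨b, hb⟩
    refine ⟨a + b, fun z => ?_⟩
    simpa [add_mul] using (ha z).add (hb z)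
  zero_mem' := ⟨0, fun z => by simp⟩
  smul_mem' := by
    rintro c f ⟨a, ha⟩
    refine ⟨c • a, fun z => ?_⟩
    simpa [mul_assoc] using (ha z).mul_left c

/-- The Hardy space `H²` of the unit disc. -/
def HardySpace : Type := hardySubmodule

namespace HardySpace

instance : AddCommGroup HardySpace := inferInstanceAs (AddCommGroup hardySubmodule)
instance : Module ℂ HardySpace := inferInstanceAs (Module ℂ hardySubmodule)

instance : CoeFun HardySpace (fun _ => 𝔻 → ℂ) := ⟨fun f => f.1⟩

@[ext] theorem ext {f g : HardySpace} (h : ∀ z : 𝔻, f z = g z) : f = g :=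
  Subtype.ext (funext h)

@[simp] theorem add_apply (f g : HardySpace) (z : 𝔻) : (f + g) z = f z + g z := rfl
@[simp] theorem smul_apply (c : ℂ) (f : HardySpace) (z : 𝔻) : (c • f) z = c * f z := rfl

/-- The sequence of Taylor coefficients at `0`. -/
def taylor (f : HardySpace) : lp (fun _ : ℕ => ℂ) 2 := f.2.choose

theorem hasSum_taylor (f : HardySpace) (z : 𝔻) :
    HasSum (fun n => f.taylor n * (z : ℂ) ^ n) (f z) := f.2.choose_spec z

theorem coeff_unique {F : 𝔻 → ℂ} {a b : ℕ → ℂ}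
    (ha : ∀ z : 𝔻, HasSum (fun n => a n * (z : ℂ) ^ n) (F z))
    (hb : ∀ z : 𝔻, HasSum (fun n => b n * (z : ℂ) ^ n) (F z)) : a = b := by
  have key : ∀ c : ℕ → ℂ, (∀ z : 𝔻, HasSum (fun n => c n * (z : ℂ) ^ n) (F z)) →
      HasFPowerSeriesAt (fun z : ℂ => if h : ‖z‖ < 1 then F (Complex.UnitDisc.mk z h) else 0)
        (FormalMultilinearSeries.ofScalars ℂ c) 0 := by
    intro c hc
    rw [hasFPowerSeriesAt_iff]
    filter_upwards [ball_mem_nhds (0 : ℂ) one_pos] with z hz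
    have hz' : ‖z‖ < 1 := by simpa using hz
    simpa [hz', FormalMultilinearSeries.coeff_ofScalars, mul_comm] using
      hc (Complex.UnitDisc.mk z hz')
  have h := (key a ha).eq_formalMultilinearSeries (key b hb)
  funext n
  simpa [FormalMultilinearSeries.coeff_ofScalars] using
    congrArg (fun p => FormalMultilinearSeries.coeff p n) h

theorem taylor_eq {f : HardySpace} {a : lp (fun _ : ℕ => ℂ) 2}
    (ha : ∀ z : 𝔻, HasSum (fun n => a n * (z : ℂ) ^ n) (f z)) : f.taylor = a :=
  Subtype.ext (coeff_unique f.hasSum_taylor ha)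

theorem taylor_add (f g : HardySpace) : (f + g).taylor = f.taylor + g.taylor :=
  taylor_eq fun z => by simpa [add_mul] using (f.hasSum_taylor z).add (g.hasSum_taylor z)

theorem taylor_smul (c : ℂ) (f : HardySpace) : (c • f).taylor = c • f.taylor :=
  taylor_eq fun z => by simpa [mul_assoc] using (f.hasSum_taylor z).mul_left c

theorem taylor_injective : Function.Injective taylor := by
  intro f g h
  ext z
  exact (f.hasSum_taylor z).unique (h ▸ g.hasSum_taylor z)

/-- Taylor coefficients as a linear map. -/
def taylorₗ : HardySpace →ₗ[ℂ] lp (fun _ : ℕ => ℂ) 2 where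
  toFun := taylor
  map_add' := taylor_add
  map_smul' := taylor_smul

/-- The norm of `H²` is the `ℓ²` norm of the sequence of Taylor coefficients. -/
instance : NormedAddCommGroup HardySpace :=
  NormedAddCommGroup.induced HardySpace (lp (fun _ : ℕ => ℂ) 2) taylorₗ taylor_injective

theorem norm_def (f : HardySpace) : ‖f‖ = ‖f.taylor‖ := rfl

/-- The inner product of `H²` is the `ℓ²` inner product of the Taylor coefficients. -/
instance : InnerProductSpace ℂ HardySpace where
  norm_smul_le c f := by
    rw [norm_def, norm_def, taylor_smul, norm_smul]
  inner f g := inner ℂ f.taylor g.taylor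
  norm_sq_eq_re_inner f := by
    rw [norm_def]; exact InnerProductSpace.norm_sq_eq_re_inner f.taylor
  conj_inner_symm f g := InnerProductSpace.conj_inner_symm f.taylor g.taylor
  add_left f g h := by rw [taylor_add]; exact InnerProductSpace.add_left _ _ _
  smul_left f g c := by rw [taylor_smul]; exact InnerProductSpace.smul_left _ _ _

theorem summable_of_lp (a : lp (fun _ : ℕ => ℂ) 2) {r : ℝ} (h0 : 0 ≤ r) (h1 : r < 1) :
    Summable fun n => ‖a n‖ * r ^ n :=
  ((summable_geometric_of_lt_one h0 h1).mul_left ‖a‖).of_nonneg_of_le (fun n => by positivity)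
    fun n => by gcongr; exact lp.norm_apply_le_norm (by norm_num) a n

/-- The element of `H²` with given Taylor coefficients. -/
def ofTaylor (a : lp (fun _ : ℕ => ℂ) 2) : HardySpace :=
  ⟨fun z => ∑' n, a n * (z : ℂ) ^ n, a, fun z => by
    refine Summable.hasSum (Summable.of_norm ?_)
    simpa using summable_of_lp a (norm_nonneg _) z.norm_lt_one⟩

theorem taylor_ofTaylor (a : lp (fun _ : ℕ => ℂ) 2) : (ofTaylor a).taylor = a :=
  taylor_eq fun z => Summable.hasSum (Summable.of_norm (by
    simpa using summable_of_lp a (norm_nonneg _) z.norm_lt_one))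

/-- `H²` is isometrically isomorphic to `ℓ²`. -/
def taylorEquiv : HardySpace ≃ₗᵢ[ℂ] lp (fun _ : ℕ => ℂ) 2 where
  toLinearEquiv := LinearEquiv.ofBijective taylorₗ
    ⟨taylor_injective, fun a => ⟨ofTaylor a, taylor_ofTaylor a⟩⟩
  norm_map' _ := rfl

instance : CompleteSpace HardySpace :=
  (completeSpace_congr (e := taylorEquiv.toEquiv)
    taylorEquiv.isometry.isUniformInducing.isUniformEmbedding).2 inferInstance

end HardySpace

/-! ### Analytic Toeplitz operators -/

/-- `φ` is bounded and analytic on the open unit disc. -/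
structure IsBoundedAnalytic (φ : ℂ → ℂ) : Prop where
  differentiableOn : DifferentiableOn ℂ φ (ball 0 1)
  bounded : ∃ C : ℝ, ∀ z ∈ ball (0 : ℂ) 1, ‖φ z‖ ≤ C

namespace HardySpace

/-- A form of Parseval's identity: if `u`, `v` are absolutely convergent Fourier series with
nonnegative frequencies and `|v| ≤ C |u|` on the circle, then the same holds for the `ℓ²` norms. -/
theorem parseval_le {d e : ℕ → ℂ} (hd : Summable fun n => ‖d n‖) (he : Summable fun n => ‖e n‖)
    {C : ℝ}
    (h : ∀ w : ℂ, ‖w‖ = 1 → ‖∑' n, e n * w ^ n‖ ≤ C * ‖∑' n, d n * w ^ n‖) (N : ℕ) :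
    ∑ n ∈ Finset.range N, ‖e n‖ ^ 2 ≤ C ^ 2 * ∑' n, ‖d n‖ ^ 2 := by
  have : Fact ((0 : ℝ) < 1) := ⟨one_pos⟩
  let μ : MeasureTheory.Measure (AddCircle (1 : ℝ)) := AddCircle.haarAddCircle
  let L : C(AddCircle (1 : ℝ), ℂ) →L[ℂ] MeasureTheory.Lp ℂ 2 μ := ContinuousMap.toLp 2 μ ℂ
  let v : ℕ → MeasureTheory.Lp ℂ 2 μ := fun n => fourierLp 2 (n : ℤ)
  have hv : Orthonormal ℂ v :=
    (orthonormal_fourier (T := 1)).comp (fun n : ℕ => (n : ℤ)) Nat.cast_injective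
  have key : ∀ c : ℕ → ℂ, (Summable fun n => ‖c n‖) → ∃ F : C(AddCircle (1 : ℝ), ℂ),
      (∀ x, F x = ∑' n, c n * (fourier 1 x : ℂ) ^ n) ∧
        HasSum (fun n => ‖c n‖ ^ 2) (‖L F‖ ^ 2) := by
    intro c hc
    have hs : Summable fun n : ℕ => c n • (fourier (n : ℤ) : C(AddCircle (1 : ℝ), ℂ)) := by
      refine Summable.of_norm ?_
      simpa [norm_smul, fourier_norm] using hc
    refine ⟨∑' n : ℕ, c n • (fourier (n : ℤ) : C(AddCircle (1 : ℝ), ℂ)), fun x => ?_, ?_⟩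
    · have := (ContinuousMap.evalCLM ℂ x).hasSum hs.hasSum
      refine (this.tsum_eq.symm.trans (tsum_congr fun n => ?_))
      simp [fourier_apply, AddCircle.toCircle_nsmul]
    · have h1 := L.hasSum hs.hasSum
      have h2 := (continuous_norm.pow 2).continuousAt.tendsto.comp h1
      refine h2.congr fun s => ?_
      have h3 : ∑ n ∈ s, L (c n • (fourier (n : ℤ) : C(AddCircle (1 : ℝ), ℂ))) =
          ∑ n ∈ s, c n • v n := Finset.sum_congr rfl fun n _ => map_smul L _ _
      have h4 := hv.inner_sum c c s
      simp only [Function.comp_apply]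
      rw [h3]
      have h5 : ((‖∑ n ∈ s, c n • v n‖ ^ 2 : ℝ) : ℂ) = ((∑ n ∈ s, ‖c n‖ ^ 2 : ℝ) : ℂ) := by
        rw [inner_self_eq_norm_sq_to_K] at h4
        push_cast
        refine h4.trans (Finset.sum_congr rfl fun n _ => ?_)
        exact Complex.conj_mul' (c n)
      exact_mod_cast h5
  obtain ⟨F, hF, hFs⟩ := key d hd
  obtain ⟨G, hG, hGs⟩ := key e he
  have hle : ‖L G‖ ≤ C * ‖L F‖ := by
    refine MeasureTheory.Lp.norm_le_mul_norm_of_ae_le_mul ?_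
    filter_upwards [ContinuousMap.coeFn_toLp (p := 2) (𝕜 := ℂ) μ F,
      ContinuousMap.coeFn_toLp (p := 2) (𝕜 := ℂ) μ G] with x hx hy
    change ‖(ContinuousMap.toLp 2 μ ℂ G) x‖ ≤ C * ‖(ContinuousMap.toLp 2 μ ℂ F) x‖
    rw [hx, hy, hF, hG]
    exact h _ (by simpa [fourier_apply] using Circle.norm_coe _)
  calc ∑ n ∈ Finset.range N, ‖e n‖ ^ 2 ≤ ‖L G‖ ^ 2 :=
        sum_le_hasSum _ (fun n _ => by positivity) hGs
    _ ≤ (C * ‖L F‖) ^ 2 := by gcongr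
    _ = C ^ 2 * ∑' n, ‖d n‖ ^ 2 := by rw [mul_pow, hFs.tsum_eq]

theorem norm_taylor_sq (a : lp (fun _ : ℕ => ℂ) 2) : HasSum (fun n => ‖a n‖ ^ 2) (‖a‖ ^ 2) := by
  simpa using lp.hasSum_norm (p := 2) (by norm_num) a

/-- The product of a bounded analytic function and a function in `H²` is in `H²`, with a norm
estimate. -/
theorem exists_mul {φ : ℂ → ℂ} (hφ : IsBoundedAnalytic φ) {C : ℝ} (hC : 0 ≤ C)
    (hb : ∀ z ∈ ball (0 : ℂ) 1, ‖φ z‖ ≤ C) (f : HardySpace) :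
    ∃ g : HardySpace, (∀ z : 𝔻, g z = φ z * f z) ∧ ‖g‖ ≤ C * ‖f‖ := by
  let c : ℕ → ℂ := fun n => (n.factorial : ℂ)⁻¹ * iteratedDeriv n φ 0
  have hc : ∀ z : 𝔻, HasSum (fun n => c n * (z : ℂ) ^ n) (φ z) := by
    intro z
    have hz : (z : ℂ) ∈ ball (0 : ℂ) 1 := by simpa using z.norm_lt_one
    have := Complex.hasSum_taylorSeries_on_ball (c := 0) (r := 1) hφ.differentiableOn hz
    simpa [c, mul_assoc, mul_comm, mul_left_comm] using this
  let a := f.taylor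
  have ha : ∀ z : 𝔻, HasSum (fun n => a n * (z : ℂ) ^ n) (f z) := f.hasSum_taylor
  let b : ℕ → ℂ := fun n => ∑ p ∈ Finset.HasAntidiagonal.antidiagonal n, c p.1 * a p.2
  have hterm : ∀ (z : 𝔻) (n : ℕ), ∑ p ∈ Finset.HasAntidiagonal.antidiagonal n,
      c p.1 * (z : ℂ) ^ p.1 * (a p.2 * (z : ℂ) ^ p.2) = b n * (z : ℂ) ^ n := by
    intro z n
    rw [Finset.sum_mul]
    refine Finset.sum_congr rfl fun p hp => ?_
    rw [← Finset.HasAntidiagonal.mem_antidiagonal.1 hp, pow_add]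
    ring
  have hbn : ∀ z : 𝔻, Summable fun n => ‖b n * (z : ℂ) ^ n‖ := by
    intro z
    have := summable_norm_sum_mul_antidiagonal_of_summable_norm (hc z).summable.norm
      (ha z).summable.norm
    simpa only [hterm] using this
  have hb' : ∀ z : 𝔻, HasSum (fun n => b n * (z : ℂ) ^ n) (φ z * f z) := by
    intro z
    have := tsum_mul_tsum_eq_tsum_sum_antidiagonal_of_summable_norm (hc z).summable.norm
      (ha z).summable.norm
    rw [(hc z).tsum_eq, (ha z).tsum_eq] at this
    rw [this]
    simp only [hterm]
    exact (hbn z).of_norm.hasSum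
  have hr : ∀ (N : ℕ) (r : ℝ), r ∈ Set.Ioo (0 : ℝ) 1 →
      ∑ n ∈ Finset.range N, ‖b n * (r : ℂ) ^ n‖ ^ 2 ≤ C ^ 2 * ‖a‖ ^ 2 := by
    rintro N r ⟨h0, h1⟩
    have hn : ∀ w : ℂ, ‖w‖ = 1 → ‖(r : ℂ) * w‖ < 1 := by
      intro w hw
      simpa [hw, abs_of_pos h0] using h1
    have hr1 : ‖(r : ℂ)‖ < 1 := by simpa [abs_of_pos h0] using h1
    have hsa := (ha (Complex.UnitDisc.mk r hr1)).summable.norm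
    have hsb := hbn (Complex.UnitDisc.mk r hr1)
    refine (parseval_le (C := C) hsa hsb ?_ N).trans ?_
    · intro w hw
      have e1 := (hb' (Complex.UnitDisc.mk (r * w) (hn w hw))).tsum_eq
      have e2 := (ha (Complex.UnitDisc.mk (r * w) (hn w hw))).tsum_eq
      simp only [Complex.UnitDisc.coe_mk, mul_pow, ← mul_assoc] at e1 e2
      simp only [Complex.UnitDisc.coe_mk]
      rw [e1, e2, norm_mul]
      gcongr
      exact hb _ (by simpa using hn w hw)
    · gcongr
      rw [← (norm_taylor_sq a).tsum_eq]
      refine Summable.tsum_le_tsum (fun n => ?_) ?_ (norm_taylor_sq a).summable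
      · have : ‖(r : ℂ)‖ ^ n ≤ 1 := pow_le_one₀ (norm_nonneg _) hr1.le
        simp only [Complex.UnitDisc.coe_mk, norm_mul, norm_pow]
        gcongr
        exact mul_le_of_le_one_right (norm_nonneg _) this
      · refine (norm_taylor_sq a).summable.of_nonneg_of_le (fun n => by positivity) fun n => ?_
        have : ‖(r : ℂ)‖ ^ n ≤ 1 := pow_le_one₀ (norm_nonneg _) hr1.le
        simp only [Complex.UnitDisc.coe_mk, norm_mul, norm_pow]
        gcongr
        exact mul_le_of_le_one_right (norm_nonneg _) this
  have hN : ∀ N : ℕ, ∑ n ∈ Finset.range N, ‖b n‖ ^ 2 ≤ C ^ 2 * ‖a‖ ^ 2 := by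
    intro N
    have hcont : Continuous fun r : ℝ => ∑ n ∈ Finset.range N, ‖b n * (r : ℂ) ^ n‖ ^ 2 := by
      fun_prop
    have ht := (hcont.tendsto 1).mono_left (nhdsWithin_le_nhds (s := Set.Iio 1))
    simp only [Complex.ofReal_one, one_pow, mul_one] at ht
    refine le_of_tendsto ht ?_
    filter_upwards [Ioo_mem_nhdsLT (show (0 : ℝ) < 1 from one_pos)] with r hr'
    exact hr N r hr'
  have hsum : Summable fun n => ‖b n‖ ^ 2 :=
    summable_of_sum_range_le (fun n => by positivity) hN
  let B : lp (fun _ : ℕ => ℂ) 2 := ⟨b, memℓp_gen (by simpa using hsum)⟩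
  let g : HardySpace := ⟨fun z => φ z * f z, B, hb'⟩
  refine ⟨g, fun z => rfl, ?_⟩
  have hgB : g.taylor = B := taylor_eq hb'
  rw [norm_def, norm_def, hgB]
  refine le_of_sq_le_sq ?_ (by positivity)
  rw [mul_pow, ← (norm_taylor_sq B).tsum_eq]
  exact Real.tsum_le_of_sum_range_le (fun n => by positivity) hN

/-- The analytic Toeplitz operator `T_φ` on `H²`, i.e. multiplication by the bounded analytic
function `φ`. -/
def toeplitz (φ : ℂ → ℂ) (hφ : IsBoundedAnalytic φ) : HardySpace →L[ℂ] HardySpace := by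
  have h := exists_mul hφ (le_max_left 0 hφ.bounded.choose)
    (fun z hz => (hφ.bounded.choose_spec z hz).trans (le_max_right _ _))
  exact LinearMap.mkContinuous
    { toFun := fun f => (h f).choose
      map_add' := fun f g => by
        ext z
        rw [(h (f + g)).choose_spec.1, add_apply, add_apply, (h f).choose_spec.1,
          (h g).choose_spec.1, mul_add]
      map_smul' := fun c f => by
        ext z
        rw [(h (c • f)).choose_spec.1, smul_apply, RingHom.id_apply, smul_apply,
          (h f).choose_spec.1, mul_left_comm] }
    (max 0 hφ.bounded.choose) fun f => (h f).choose_spec.2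

@[simp] theorem toeplitz_apply (φ : ℂ → ℂ) (hφ : IsBoundedAnalytic φ) (f : HardySpace) (z : 𝔻) :
    toeplitz φ hφ f z = φ z * f z :=
  (exists_mul hφ (le_max_left 0 hφ.bounded.choose)
    (fun z hz => (hφ.bounded.choose_spec z hz).trans (le_max_right _ _)) f).choose_spec.1 z

end HardySpace

theorem isBoundedAnalytic_sq_add_self : IsBoundedAnalytic (fun z : ℂ => z ^ 2 + z) where
  differentiableOn := by fun_prop
  bounded := ⟨2, fun z hz => by
    have hz' : ‖z‖ < 1 := by simpa using hz
    calc ‖z ^ 2 + z‖ ≤ ‖z‖ ^ 2 + ‖z‖ := (norm_add_le _ _).trans_eq (by rw [norm_pow])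
      _ ≤ 2 := by nlinarith [norm_nonneg z]⟩

end

/-!
Write `φ z = z² + z`, so that the two solutions of `φ x = c` are `x` and `-1 - x`, and they coincide
exactly for the critical value `c = -1/4`. The condition `l ∈ -4 φ(U)` says that this critical value
is attained by `φ / l` on the disc.

Suppose that it is not attained and let `c = -l / 4`. The domain `φ(U)` is star-shaped about `0`
(`one_le_norm_roots_mul`), so it misses the whole ray `t c`, `t ≥ 1`; equivalently `φ / l + 1/4`
avoids the half-line `(-∞, 0]`. Hence `ψ = -1/2 + √(φ / l + 1/4)`, with the principal root, is
analytic and satisfies `φ ∘ ψ = φ / l`. As `|l| ≥ 4` and `ψ` is the root of smaller modulus, its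
range lies in a smaller disc (`exists_inner_branch`), and `f ↦ f ∘ ψ` is a bounded operator with the
required intertwining property.

Suppose conversely that `X (l T) = T X` with `l ≠ 0`, and put `g = X 1`, `h = X z`. The functional
`f ↦ (X f)(w)` annihilates `(φ - φ(w) / l) H²`. For some points `w` close to `0` one root of
`φ x = φ(w) / l` lies outside the closed disc, and then `h(w) = x g(w)` for the other root `x`
(`apply_monomial_one_of_outer_root`). By the identity theorem `h² + h g = (φ / l) g²` on the disc,
that is, `(h + g / 2)² = (φ / l + 1/4) g²`. If `l = -4 φ(w)` with `w` in the disc and `l ≠ 1`, then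
`φ / l + 1/4` has a simple zero at `w`, and comparing the parities of the orders of vanishing gives
`g = 0`. Then `h = 0` as well, and `X = 0` because every polynomial is a combination of `1` and `z`
over the polynomials in `φ`. For `l = 0`, `X = 0` since `T` is injective.
-/

/-! ### Analytic functions and composition operators on `H²` -/

namespace HardySpace

/-- The function on all of `ℂ` given by the Taylor series of `f`; only its values on the open unit
disc, where the series converges, are meaningful. -/
noncomputable def extend (f : HardySpace) (z : ℂ) : ℂ := ∑' n, f.taylor n * z ^ n

theorem extend_coe (f : HardySpace) (z : 𝔻) : f.extend z = f z :=
  (f.hasSum_taylor z).tsum_eq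

theorem extend_of_norm_lt (f : HardySpace) {z : ℂ} (hz : ‖z‖ < 1) :
    f.extend z = f (Complex.UnitDisc.mk z hz) :=
  f.extend_coe (Complex.UnitDisc.mk z hz)

theorem extend_add (f g : HardySpace) {z : ℂ} (hz : ‖z‖ < 1) :
    (f + g).extend z = f.extend z + g.extend z := by
  simp only [extend_of_norm_lt _ hz, add_apply]

theorem extend_smul (c : ℂ) (f : HardySpace) {z : ℂ} (hz : ‖z‖ < 1) :
    (c • f).extend z = c * f.extend z := by
  simp only [extend_of_norm_lt _ hz, smul_apply]

theorem ext_extend {f g : HardySpace} (h : Set.EqOn f.extend g.extend (ball 0 1)) : f = g := by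
  ext z
  rw [← extend_coe, ← extend_coe]
  exact h (by simpa using z.norm_lt_one)

theorem analyticOnNhd_extend (f : HardySpace) : AnalyticOnNhd ℂ f.extend (ball 0 1) := by
  let p := FormalMultilinearSeries.ofScalars ℂ (fun n => f.taylor n)
  have hr : (1 : ℝ≥0∞) ≤ p.radius := by
    refine p.le_radius_of_bound (r := 1) ‖f.taylor‖ fun n => ?_
    rw [NNReal.coe_one, one_pow, mul_one, FormalMultilinearSeries.ofScalars_norm]
    exact lp.norm_apply_le_norm (by norm_num) _ n
  have hp := p.hasFPowerSeriesOnBall (lt_of_lt_of_le one_pos hr)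
  have hs : p.sum = f.extend := by
    ext z
    refine tsum_congr fun n => ?_
    simp [p, mul_comm]
  rw [hs] at hp
  intro z hz
  refine hp.analyticAt_of_mem (lt_of_lt_of_le ?_ hr)
  rw [mem_ball, ← edist_lt_ofReal] at hz
  simpa using hz

theorem norm_extend_le (f : HardySpace) {z : ℂ} {r : ℝ} (hz : ‖z‖ ≤ r) (hr : r < 1) :
    ‖f.extend z‖ ≤ (1 - r)⁻¹ * ‖f‖ := by
  have h0 : 0 ≤ r := (norm_nonneg z).trans hz
  refine tsum_of_norm_bounded ((hasSum_geometric_of_lt_one h0 hr).mul_right ‖f‖) fun n => ?_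
  rw [norm_mul, norm_pow, mul_comm]
  gcongr
  exact lp.norm_apply_le_norm (by norm_num) _ n

/-- The monomial `z ^ n` as an element of `H²`. -/
noncomputable def monomial (n : ℕ) : HardySpace := ofTaylor (lp.single 2 n 1)

@[simp] theorem monomial_apply (n : ℕ) (z : 𝔻) : monomial n z = (z : ℂ) ^ n := by
  refine ((monomial n).hasSum_taylor z).unique ?_
  rw [monomial, taylor_ofTaylor]
  convert hasSum_single (f := fun m => (lp.single 2 n (1 : ℂ) : lp (fun _ : ℕ => ℂ) 2) m *
    (z : ℂ) ^ m) n fun m hm => ?_ using 1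
  · simp
  · simp [Pi.single_eq_of_ne hm]

theorem extend_monomial (n : ℕ) {z : ℂ} (hz : ‖z‖ < 1) : (monomial n).extend z = z ^ n := by
  rw [extend_of_norm_lt _ hz, monomial_apply, Complex.UnitDisc.coe_mk]

theorem norm_monomial (n : ℕ) : ‖monomial n‖ = 1 := by
  rw [norm_def, monomial, taylor_ofTaylor, lp.norm_single (by norm_num), norm_one]

/-- The polynomials are dense in `H²`: a bounded operator is determined by its values on the
monomials. -/
theorem clm_eq_zero_of_monomial {X : HardySpace →L[ℂ] HardySpace}
    (hX : ∀ n, X (monomial n) = 0) : X = 0 := by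
  ext1 f
  let e := taylorEquiv.symm
  have h1 : HasSum (fun n => lp.single 2 n (f.taylor n)) f.taylor :=
    lp.hasSum_single (by norm_num) _
  have h2 := (X.comp (e.toContinuousLinearEquiv : lp (fun _ : ℕ => ℂ) 2 →L[ℂ] HardySpace)).hasSum h1
  have h3 : e f.taylor = f := taylorEquiv.symm_apply_apply f
  have h4 : ∀ n, e (lp.single 2 n (f.taylor n)) = f.taylor n • monomial n := by
    intro n
    rw [LinearIsometryEquiv.symm_apply_eq, map_smul]
    change _ = f.taylor n • (monomial n).taylor
    rw [monomial, taylor_ofTaylor, ← lp.single_smul, smul_eq_mul, mul_one]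
  simp only [ContinuousLinearMap.comp_apply, ContinuousLinearEquiv.coe_coe,
    LinearIsometryEquiv.coe_toContinuousLinearEquiv, h3, h4, map_smul, hX, smul_zero] at h2
  exact h2.unique hasSum_zero

/-- A bounded analytic function is in `H²`, with norm at most its supremum norm. -/
theorem exists_of_bounded {F : ℂ → ℂ} (hF : DifferentiableOn ℂ F (ball 0 1)) {C : ℝ} (hC : 0 ≤ C)
    (hb : ∀ z ∈ ball (0 : ℂ) 1, ‖F z‖ ≤ C) :
    ∃ g : HardySpace, (∀ z : 𝔻, g z = F z) ∧ ‖g‖ ≤ C := by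
  obtain ⟨g, hg, hn⟩ := exists_mul ⟨hF, C, hb⟩ hC hb (monomial 0)
  exact ⟨g, fun z => by simp [hg], by simpa [norm_monomial] using hn⟩

/-- Composition with an analytic self-map of the disc whose range stays away from the unit circle
is a bounded operator on `H²`. -/
theorem exists_comp {ψ : ℂ → ℂ} (hψ : DifferentiableOn ℂ ψ (ball 0 1)) {r : ℝ} (hr : r < 1)
    (hb : ∀ z ∈ ball (0 : ℂ) 1, ‖ψ z‖ ≤ r) :
    ∃ X : HardySpace →L[ℂ] HardySpace, ∀ (f : HardySpace) (z : 𝔻), X f z = f.extend (ψ z) := by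
  have h (f : HardySpace) : ∃ g : HardySpace, (∀ z : 𝔻, g z = f.extend (ψ z)) ∧
      ‖g‖ ≤ (1 - r)⁻¹ * ‖f‖ := by
    have h1 : 0 < 1 - r := by linarith
    refine exists_of_bounded (F := fun z => f.extend (ψ z)) ?_ (by positivity)
      fun z hz => f.norm_extend_le (hb z hz) hr
    exact f.analyticOnNhd_extend.differentiableOn.comp hψ fun z hz =>
      mem_ball_zero_iff.2 ((hb z hz).trans_lt hr)
  have hlt (z : 𝔻) : ‖ψ z‖ < 1 := (hb z (by simpa using z.norm_lt_one)).trans_lt hr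
  choose Y hY hn using h
  refine ⟨LinearMap.mkContinuous
    { toFun := Y
      map_add' := fun f g => by
        ext z
        rw [hY, extend_add _ _ (hlt z), add_apply, hY, hY]
      map_smul' := fun c f => by
        ext z
        rw [hY, extend_smul _ _ (hlt z), RingHom.id_apply, smul_apply, hY] } _ hn, hY⟩

end HardySpace

/-! ### The inner branch of the inverse of `z² + z` -/

/-- For `c = z² + z`, whose preimages under `x ↦ x² + x` are `z` and `-1 - z`: a quantity depending
on `c` alone whose sign tells whether exactly one of the two preimages is in the unit disc. -/
theorem normSq_identity (z : ℂ) :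
    Complex.normSq (z ^ 2 + z) ^ 2 - 3 * Complex.normSq (z ^ 2 + z) - 2 * (z ^ 2 + z).re =
      (Complex.normSq z - 1) * (Complex.normSq (z + 1) - 1) *
        (Complex.normSq (z ^ 2 + z) + Complex.normSq z + Complex.normSq (z + 1)) := by
  simp only [Complex.normSq_apply, pow_two, Complex.add_re, Complex.add_im, Complex.mul_re,
    Complex.mul_im, Complex.one_re, Complex.one_im]
  ring

theorem exists_sq_add_self (c : ℂ) : ∃ z : ℂ, z ^ 2 + z = c := by
  obtain ⟨s, hs⟩ := IsAlgClosed.exists_pow_nat_eq (c + 1 / 4) two_pos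
  exact ⟨s - 1 / 2, by linear_combination hs⟩

theorem one_le_norm_of_roots {c : ℂ} (hc : ∀ z : ℂ, z ^ 2 + z = c → 1 ≤ ‖z‖) : 1 ≤ ‖c‖ := by
  obtain ⟨x, hx⟩ := exists_sq_add_self c
  have h1 := hc x hx
  have h2 := hc (-1 - x) (by linear_combination hx)
  have h3 : c = -(x * (-1 - x)) := by linear_combination -hx
  rw [h3, norm_neg, norm_mul]
  nlinarith

/-- The image of the unit disc under `z ↦ z² + z` is star-shaped about `0`, stated for the
complement. -/
theorem one_le_norm_roots_mul {c : ℂ} (hc : ∀ z : ℂ, z ^ 2 + z = c → 1 ≤ ‖z‖) {t : ℝ}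
    (ht : 1 ≤ t) {z : ℂ} (hz : z ^ 2 + z = t * c) : 1 ≤ ‖z‖ := by
  by_contra! hlt
  have hN1 : 1 ≤ Complex.normSq c := by
    rw [Complex.normSq_eq_norm_sq]
    nlinarith [one_le_norm_of_roots hc]
  have hcond : 0 ≤ Complex.normSq c ^ 2 - 3 * Complex.normSq c - 2 * c.re := by
    obtain ⟨x, hx⟩ := exists_sq_add_self c
    have h1 := hc x hx
    have h2 := hc (-1 - x) (by linear_combination hx)
    rw [show -1 - x = -(x + 1) by ring, norm_neg] at h2
    have hid := normSq_identity x
    rw [hx] at hid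
    rw [hid]
    have h1' : 0 ≤ Complex.normSq x - 1 := by rw [Complex.normSq_eq_norm_sq]; nlinarith
    have h2' : 0 ≤ Complex.normSq (x + 1) - 1 := by rw [Complex.normSq_eq_norm_sq]; nlinarith
    have := Complex.normSq_nonneg c
    have := Complex.normSq_nonneg x
    have := Complex.normSq_nonneg (x + 1)
    positivity
  have hid := normSq_identity z
  have hprod : Complex.normSq (t * c) = Complex.normSq z * Complex.normSq (z + 1) := by
    rw [← hz, ← Complex.normSq_mul]
    congr 1
    ring
  have ha : Complex.normSq z < 1 := by
    rw [Complex.normSq_eq_norm_sq]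
    nlinarith [norm_nonneg z]
  have ha0 := Complex.normSq_nonneg z
  rw [hz] at hid
  have hscale : Complex.normSq (t * c) = t ^ 2 * Complex.normSq c := by
    rw [Complex.normSq_mul, Complex.normSq_ofReal]
    ring
  rw [Complex.re_ofReal_mul] at hid
  generalize Complex.normSq (t * c) = M at *
  generalize Complex.normSq c = N at *
  generalize Complex.normSq z = a at *
  generalize Complex.normSq (z + 1) = b at *
  have ht2 : 1 ≤ t ^ 2 := one_le_pow₀ ht
  have hM : 1 ≤ M := by
    rw [hscale]
    nlinarith
  have hb : 1 < b := by
    by_contra! hb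
    nlinarith
  have hneg : (a - 1) * (b - 1) * (M + a + b) < 0 :=
    mul_neg_of_neg_of_pos (mul_neg_of_neg_of_pos (by linarith) (by linarith)) (by linarith)
  have hpos : 0 ≤ M ^ 2 - 3 * M - 2 * (t * c.re) := by
    have e : M ^ 2 - 3 * M - 2 * (t * c.re) =
        t * (N ^ 2 - 3 * N - 2 * c.re) + t * N * ((t - 1) * ((t ^ 2 + t + 1) * N - 3)) := by
      rw [hscale]
      ring
    rw [e]
    have h1 : 0 ≤ t - 1 := by linarith
    have h2 : 0 ≤ (t ^ 2 + t + 1) * N - 3 := by nlinarith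
    positivity
  linarith

/-- If neither root of `x² + x = -l / 4` lies in the unit disc, then the inner branch `ψ` of
`φ⁻¹ ∘ (φ / l)`, where `φ z = z² + z`, is single-valued and maps the unit disc to a disc of radius
less than `1`. -/
theorem exists_inner_branch {l : ℂ} (hl : ∀ z : ℂ, z ^ 2 + z = -l / 4 → 1 ≤ ‖z‖) :
    ∃ (ψ : ℂ → ℂ) (r : ℝ), DifferentiableOn ℂ ψ (ball 0 1) ∧ r < 1 ∧
      (∀ z ∈ ball (0 : ℂ) 1, ‖ψ z‖ ≤ r) ∧ ∀ z, l * (ψ z ^ 2 + ψ z) = z ^ 2 + z := by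
  have hl4 : 4 ≤ ‖l‖ := by
    have := one_le_norm_of_roots hl
    rw [norm_div, norm_neg, Complex.norm_ofNat] at this
    linarith
  have hl0 : l ≠ 0 := by
    rintro rfl
    norm_num at hl4
  let u : ℂ → ℂ := fun z => (z ^ 2 + z) / l + 1 / 4
  have hslit : ∀ z ∈ ball (0 : ℂ) 1, u z ∈ Complex.slitPlane := by
    intro z hz
    by_contra hu
    rw [Complex.mem_slitPlane_iff, not_or, not_lt, not_not] at hu
    have hreal : u z = ((u z).re : ℂ) := Complex.ext rfl (by simp [hu.2])
    refine (mem_ball_zero_iff.1 hz).not_ge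
      (one_le_norm_roots_mul hl (t := 1 - 4 * (u z).re) (by linarith [hu.1]) ?_)
    have : z ^ 2 + z = l * (u z - 1 / 4) := by
      simp only [u]
      field_simp
      ring
    rw [this]
    push_cast
    rw [← hreal]
    ring
  have hsq (z : ℂ) : (u z ^ (2⁻¹ : ℂ)) ^ 2 = u z := Complex.cpow_ofNat_inv_pow _ 2
  have hroot (z : ℂ) : l * ((u z ^ (2⁻¹ : ℂ) - 1 / 2) ^ 2 + (u z ^ (2⁻¹ : ℂ) - 1 / 2)) =
      z ^ 2 + z := by
    have : l * ((u z ^ (2⁻¹ : ℂ) - 1 / 2) ^ 2 + (u z ^ (2⁻¹ : ℂ) - 1 / 2)) =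
        l * ((u z ^ (2⁻¹ : ℂ)) ^ 2 - 1 / 4) := by ring
    rw [this, hsq]
    simp only [u]
    field_simp
    ring
  refine ⟨fun z => u z ^ (2⁻¹ : ℂ) - 1 / 2, 3 / 4, ?_, by norm_num, fun z hz => ?_, hroot⟩
  · have hu : DifferentiableOn ℂ u (ball 0 1) := by fun_prop
    exact (hu.cpow_const hslit).sub_const _
  · -- The two roots have product of modulus at most `1 / 2`, and this one is the smaller.
    change ‖u z ^ (2⁻¹ : ℂ) - 1 / 2‖ ≤ 3 / 4
    have hr := hroot z
    have hre : 0 ≤ (u z ^ (2⁻¹ : ℂ)).re := by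
      rw [Complex.cpow_inv_two_re]
      positivity
    generalize u z ^ (2⁻¹ : ℂ) = s at hr hre
    have hz1 : ‖z‖ < 1 := mem_ball_zero_iff.1 hz
    have hmul : ‖s - 1 / 2‖ * ‖s + 1 / 2‖ ≤ 1 / 2 := by
      have h1 : ‖l‖ * (‖s - 1 / 2‖ * ‖s + 1 / 2‖) ≤ 2 := by
        rw [← norm_mul, ← norm_mul, show l * ((s - 1 / 2) * (s + 1 / 2)) = z ^ 2 + z by
          rw [← hr]; ring]
        calc ‖z ^ 2 + z‖ ≤ ‖z‖ ^ 2 + ‖z‖ := (norm_add_le _ _).trans_eq (by rw [norm_pow])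
          _ ≤ 2 := by nlinarith [norm_nonneg z]
      nlinarith [mul_nonneg (norm_nonneg (s - 1 / 2)) (norm_nonneg (s + 1 / 2))]
    have hle : ‖s - 1 / 2‖ ≤ ‖s + 1 / 2‖ := by
      refine le_of_sq_le_sq ?_ (norm_nonneg _)
      rw [← Complex.normSq_eq_norm_sq, ← Complex.normSq_eq_norm_sq, Complex.normSq_sub,
        Complex.normSq_add]
      have : (s * (starRingEnd ℂ) (1 / 2)).re = s.re / 2 := by
        simp [Complex.mul_re]
        ring
      rw [this]
      linarith
    nlinarith [norm_nonneg (s - 1 / 2)]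

/-- Existence half: the composition operator with the inner branch of `φ⁻¹ ∘ (φ / l)`
intertwines. -/
theorem mem_extendedEigenvalues_of_roots {l : ℂ}
    (hl : ∀ z : ℂ, z ^ 2 + z = -l / 4 → 1 ≤ ‖z‖) :
    l ∈ extendedEigenvalues
      (HardySpace.toeplitz (fun z : ℂ => z ^ 2 + z) isBoundedAnalytic_sq_add_self) := by
  obtain ⟨ψ, r, hd, hr, hb, hψ⟩ := exists_inner_branch hl
  obtain ⟨X, hX⟩ := HardySpace.exists_comp hd hr hb
  have hlt (z : 𝔻) : ‖ψ z‖ < 1 := (hb z (by simpa using z.norm_lt_one)).trans_lt hr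
  refine ⟨X, fun h0 => ?_, ?_⟩
  · have h := hX (HardySpace.monomial 0) 0
    rw [h0, HardySpace.extend_monomial _ (hlt 0), pow_zero] at h
    exact zero_ne_one h
  · ext f z
    simp only [ContinuousLinearMap.comp_apply, _root_.smul_apply, map_smul,
      HardySpace.smul_apply, HardySpace.toeplitz_apply, hX]
    rw [HardySpace.extend_of_norm_lt _ (hlt z), HardySpace.extend_of_norm_lt _ (hlt z),
      HardySpace.toeplitz_apply, ← mul_assoc, Complex.UnitDisc.coe_mk, hψ]

/-! ### The obstruction at the critical point -/

open HardySpace in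
/-- If a root `y` of `x² + x = φ w / l`, where `φ z = z² + z`, lies outside the closed disc, then
`f ↦ (X f) w` annihilates `(z + 1 + y) H²`: it kills `(φ - φ w / l) H²`, and `z - y` is invertible
in `H^∞`. -/
theorem apply_monomial_one_of_outer_root {l : ℂ} {X : HardySpace →L[ℂ] HardySpace}
    (hX : X ∘L (l • toeplitz (fun z : ℂ => z ^ 2 + z) isBoundedAnalytic_sq_add_self) =
      toeplitz (fun z : ℂ => z ^ 2 + z) isBoundedAnalytic_sq_add_self ∘L X)
    (w : 𝔻) {y : ℂ} (hy : 1 < ‖y‖) (hyw : l * (y ^ 2 + y) = (w : ℂ) ^ 2 + w) (hl : l ≠ 0) :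
    X (monomial 1) w = (-1 - y) * X (monomial 0) w := by
  have hne {z : ℂ} (hz : ‖z‖ < 1) : z - y ≠ 0 := by
    intro h
    rw [sub_eq_zero.1 h] at hz
    linarith
  have hy1 : 0 < ‖y‖ - 1 := by linarith
  obtain ⟨q, hq, -⟩ := exists_of_bounded (F := fun z => (z - y)⁻¹) (C := (‖y‖ - 1)⁻¹)
    (DifferentiableOn.inv (by fun_prop) fun z hz => hne (mem_ball_zero_iff.1 hz))
    (by positivity) (fun z hz => by
      rw [norm_inv]
      gcongr
      have := norm_sub_norm_le y z
      rw [norm_sub_rev] at this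
      linarith [mem_ball_zero_iff.1 hz])
  -- `(φ - φ w / l) q = z + 1 + y`
  have hfac : toeplitz (fun z : ℂ => z ^ 2 + z) isBoundedAnalytic_sq_add_self q =
      (y ^ 2 + y) • q + (monomial 1 + (1 + y) • monomial 0) := by
    ext z
    have := hne z.norm_lt_one
    simp only [toeplitz_apply, add_apply, smul_apply, monomial_apply, hq]
    field_simp
    ring
  have h := congrArg (fun Y : HardySpace →L[ℂ] HardySpace => Y q w) hX
  simp only [ContinuousLinearMap.comp_apply, _root_.smul_apply, map_smul, hfac,
    map_add, add_apply, smul_apply, toeplitz_apply, ← hyw] at h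
  have h' : l * (X (monomial 1) w + (1 + y) * X (monomial 0) w) = 0 := by
    linear_combination h
  have := (mul_eq_zero.1 h').resolve_left hl
  linear_combination this

open Filter Topology HardySpace in
/-- The functions `g = X 1` and `h = X z` satisfy `h² + h g = (φ / l) g²`, where `φ z = z² + z`:
there are points arbitrarily close to `0` at which `h = x g` for a root `x` of `x² + x = φ / l`. -/
theorem extend_quadratic_relation {l : ℂ} {X : HardySpace →L[ℂ] HardySpace}
    (hX : X ∘L (l • toeplitz (fun z : ℂ => z ^ 2 + z) isBoundedAnalytic_sq_add_self) =
      toeplitz (fun z : ℂ => z ^ 2 + z) isBoundedAnalytic_sq_add_self ∘L X) (hl : l ≠ 0) :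
    Set.EqOn
      (fun w => (X (monomial 1)).extend w ^ 2 +
        (X (monomial 1)).extend w * (X (monomial 0)).extend w)
      (fun w => (w ^ 2 + w) / l * (X (monomial 0)).extend w ^ 2) (ball 0 1) := by
  have hg := (X (monomial 0)).analyticOnNhd_extend
  have hh := (X (monomial 1)).analyticOnNhd_extend
  have hpre : IsPreconnected (ball (0 : ℂ) 1) := (convex_ball 0 1).isPreconnected
  refine AnalyticOnNhd.eqOn_of_preconnected_of_frequently_eq ((hh.pow 2).add (hh.mul hg))
    ((AnalyticOnNhd.div_const fun z _ => by fun_prop).mul (hg.pow 2)) hpre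
    (mem_ball_self one_pos) ?_
  -- Points `w` for which `-1 - ε`, with `ε > 0` small, is a root of `x² + x = φ w / l`.
  rw [frequently_iff]
  intro U hU
  rw [mem_nhdsWithin_iff] at hU
  obtain ⟨δ, hδ, hU⟩ := hU
  have hm : 0 < min δ 1 := lt_min hδ one_pos
  have hl' : 0 < ‖l‖ := norm_pos_iff.2 hl
  obtain ⟨ε, hε, hεδ⟩ : ∃ ε : ℝ, 0 < ε ∧ ‖l‖ * (ε ^ 2 + ε) < (min δ 1) ^ 2 := by
    have hc : Tendsto (fun ε : ℝ => ‖l‖ * (ε ^ 2 + ε)) (𝓝[>] 0) (𝓝 (‖l‖ * (0 ^ 2 + 0))) :=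
      ((by fun_prop : Continuous fun ε : ℝ => ‖l‖ * (ε ^ 2 + ε)).tendsto 0).mono_left
        nhdsWithin_le_nhds
    have := hc.eventually_lt_const (u := (min δ 1) ^ 2) (by simp; positivity)
    obtain ⟨ε, h1, h2⟩ := (this.and self_mem_nhdsWithin).exists
    exact ⟨ε, h2, h1⟩
  let d : ℂ := l * ((ε : ℂ) ^ 2 + ε)
  have hd0 : d ≠ 0 := by
    have : ((ε : ℂ) ^ 2 + ε) = ((ε ^ 2 + ε : ℝ) : ℂ) := by push_cast; rfl
    refine mul_ne_zero hl ?_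
    rw [this]
    exact_mod_cast (by positivity : ε ^ 2 + ε ≠ 0)
  have hd : ‖d‖ < (min δ 1) ^ 2 := by
    have : ((ε : ℂ) ^ 2 + ε) = ((ε ^ 2 + ε : ℝ) : ℂ) := by push_cast; rfl
    rw [norm_mul, this, Complex.norm_real, Real.norm_of_nonneg (by positivity)]
    exact hεδ
  obtain ⟨w, hw, hwlt⟩ : ∃ w : ℂ, w ^ 2 + w = d ∧ ‖w‖ < min δ 1 := by
    -- The roots have product `-d`, so one of them has modulus at most `√|d|`.
    obtain ⟨w, hw⟩ := exists_sq_add_self d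
    have hprod : ‖w‖ * ‖-1 - w‖ = ‖d‖ := by
      rw [← norm_mul, ← norm_neg, ← hw]
      ring_nf
    by_contra! hcon
    have h1 := hcon w hw
    have h2 := hcon (-1 - w) (by linear_combination hw)
    nlinarith
  have hw1 : ‖w‖ < 1 := hwlt.trans_le (min_le_right _ _)
  refine ⟨w, hU ⟨mem_ball_zero_iff.2 (hwlt.trans_le (min_le_left _ _)), ?_⟩, ?_⟩
  · rintro rfl
    exact hd0 (by rw [← hw]; ring)
  · have hy : 1 < ‖(-1 - ε : ℂ)‖ := by
      rw [show (-1 - ε : ℂ) = ((-(1 + ε) : ℝ) : ℂ) by push_cast; ring, Complex.norm_real,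
        norm_neg, Real.norm_of_nonneg (by positivity)]
      linarith
    have key := apply_monomial_one_of_outer_root hX (Complex.UnitDisc.mk w hw1) hy
      (by rw [Complex.UnitDisc.coe_mk, hw]; ring) hl
    simp only [extend_of_norm_lt _ hw1, key, hw, d]
    field_simp
    ring

open Filter Topology in
/-- A function with a zero of order one has no square root in the field of meromorphic germs. -/
theorem eventually_eq_zero_of_sq_eq_mul_sq {G g P : ℂ → ℂ} {w : ℂ} (hG : AnalyticAt ℂ G w)
    (hg : AnalyticAt ℂ g w) (hP : AnalyticAt ℂ P w) (hP0 : P w = 0) (hP' : deriv P w ≠ 0)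
    (h : ∀ᶠ z in 𝓝 w, G z ^ 2 = P z * g z ^ 2) : ∀ᶠ z in 𝓝 w, g z = 0 := by
  rw [← analyticOrderAt_eq_top]
  have h1 : analyticOrderAt (G ^ 2) w = analyticOrderAt (P * g ^ 2) w := analyticOrderAt_congr h
  rw [analyticOrderAt_mul hP (hg.pow 2), analyticOrderAt_pow hG, analyticOrderAt_pow hg,
    hP.analyticOrderAt_eq_one_of_zero_deriv_ne_zero hP0 hP'] at h1
  generalize analyticOrderAt G w = m at h1
  generalize analyticOrderAt g w = n at h1 ⊢
  by_contra hn
  lift n to ℕ using hn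
  have hm : m ≠ ⊤ := by
    rintro rfl
    rw [nsmul_eq_mul, nsmul_eq_mul, ENat.mul_top (by norm_num)] at h1
    exact absurd h1.symm (by exact_mod_cast ENat.natCast_ne_top (1 + 2 * n))
  lift m to ℕ using hm
  rw [nsmul_eq_mul, nsmul_eq_mul] at h1
  have : 2 * m = 1 + 2 * n := by exact_mod_cast h1
  omega

open HardySpace in
/-- If `X` intertwines `l T_φ` and `T_φ`, where `φ z = z² + z`, and `X 1 = X z = 0`, then `X = 0`:
every polynomial is a combination of `1` and `z` over the polynomials in `φ`. -/
theorem clm_eq_zero_of_monomial_zero_one {l : ℂ} {X : HardySpace →L[ℂ] HardySpace}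
    (hX : X ∘L (l • toeplitz (fun z : ℂ => z ^ 2 + z) isBoundedAnalytic_sq_add_self) =
      toeplitz (fun z : ℂ => z ^ 2 + z) isBoundedAnalytic_sq_add_self ∘L X) (hl : l ≠ 0)
    (h0 : X (monomial 0) = 0) (h1 : X (monomial 1) = 0) : X = 0 := by
  refine clm_eq_zero_of_monomial fun n => ?_
  have : X (monomial n) = 0 ∧ X (monomial (n + 1)) = 0 := by
    induction n with
    | zero => exact ⟨h0, h1⟩
    | succ n ih =>
      refine ⟨ih.2, ?_⟩
      have hT : toeplitz (fun z : ℂ => z ^ 2 + z) isBoundedAnalytic_sq_add_self (monomial n) =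
          monomial (n + 1 + 1) + monomial (n + 1) := by
        ext z
        simp only [toeplitz_apply, add_apply, monomial_apply]
        ring
      have h := congrArg (fun Y : HardySpace →L[ℂ] HardySpace => Y (monomial n)) hX
      simpa [hT, ih.1, ih.2, hl] using h
  exact this.1

open HardySpace in
theorem toeplitz_sq_add_self_injective : Function.Injective
    (toeplitz (fun z : ℂ => z ^ 2 + z) isBoundedAnalytic_sq_add_self) := by
  rw [injective_iff_map_eq_zero]
  intro f hf
  have hpre : IsPreconnected (ball (0 : ℂ) 1) := (convex_ball 0 1).isPreconnected
  refine ext_extend (AnalyticOnNhd.eqOn_of_preconnected_of_frequently_eq f.analyticOnNhd_extend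
    (analyticOnNhd_extend 0) hpre (mem_ball_self one_pos) (Filter.Eventually.frequently ?_))
  filter_upwards [self_mem_nhdsWithin, mem_nhdsWithin_of_mem_nhds (ball_mem_nhds (0 : ℂ) one_pos)]
    with z hz0 hz
  have hz1 : ‖z‖ < 1 := mem_ball_zero_iff.1 hz
  have h := congrArg (fun F : HardySpace => F (Complex.UnitDisc.mk z hz1)) hf
  have hne : z ^ 2 + z ≠ 0 := by
    have : z + 1 ≠ 0 := by
      intro h
      rw [eq_neg_of_add_eq_zero_left h] at hz1
      simp at hz1
    rw [show z ^ 2 + z = z * (z + 1) by ring]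
    exact mul_ne_zero hz0 this
  rw [extend_of_norm_lt _ hz1, extend_of_norm_lt _ hz1]
  simp only [toeplitz_apply, Complex.UnitDisc.coe_mk] at h
  exact (mul_eq_zero.1 (h.trans rfl)).resolve_left hne

open Filter Topology HardySpace in
/-- Non-existence half: if `-l / 4 = φ w` with `w` in the disc, where `φ z = z² + z`, then an
intertwining operator forces `w` to be the critical point of `φ`. -/
theorem eq_one_of_mem_extendedEigenvalues {l w : ℂ}
    (hmem : l ∈ extendedEigenvalues
      (toeplitz (fun z : ℂ => z ^ 2 + z) isBoundedAnalytic_sq_add_self))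
    (hw : w ∈ ball (0 : ℂ) 1) (hlw : l = -4 * (w ^ 2 + w)) : l = 1 := by
  obtain ⟨X, hX0, hX⟩ := hmem
  by_contra hl1
  refine hX0 ?_
  by_cases hl : l = 0
  · ext1 f
    have h := congrArg (fun Y : HardySpace →L[ℂ] HardySpace => Y f) hX
    refine toeplitz_sq_add_self_injective ?_
    simpa [hl] using h.symm
  have hrel := extend_quadratic_relation hX hl
  have hg := (X (monomial 0)).analyticOnNhd_extend
  have hh := (X (monomial 1)).analyticOnNhd_extend
  have hpre : IsPreconnected (ball (0 : ℂ) 1) := (convex_ball 0 1).isPreconnected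
  have hderiv (z : ℂ) : HasDerivAt (fun z : ℂ => (z ^ 2 + z) / l + 1 / 4) ((2 * z + 1) / l) z := by
    simpa using ((((hasDerivAt_id z).pow 2).add (hasDerivAt_id z)).div_const l).add_const (1 / 4)
  -- Completing the square: the discriminant `φ / l + 1 / 4` has a simple zero at `w`.
  have hgw : ∀ᶠ z in 𝓝 w, (X (monomial 0)).extend z = 0 := by
    refine eventually_eq_zero_of_sq_eq_mul_sq
      (G := fun z => (X (monomial 1)).extend z + (X (monomial 0)).extend z / 2)
      (P := fun z => (z ^ 2 + z) / l + 1 / 4) ((hh w hw).add ((hg w hw).div_const)) (hg w hw)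
      (by fun_prop) ?_ ?_ ?_
    · field_simp
      linear_combination hlw
    · rw [(hderiv w).deriv]
      refine div_ne_zero (fun h => hl1 ?_) hl
      linear_combination hlw - (2 * w + 1) * h
    · filter_upwards [isOpen_ball.mem_nhds hw] with z hz
      have := hrel hz
      simp only at this
      linear_combination this
  have hgz : Set.EqOn (X (monomial 0)).extend 0 (ball 0 1) :=
    hg.eqOn_zero_of_preconnected_of_eventuallyEq_zero hpre hw hgw
  have hz0 : Set.EqOn (0 : HardySpace).extend 0 (ball 0 1) := fun z hz => by
    rw [extend_of_norm_lt _ (mem_ball_zero_iff.1 hz)]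
    rfl
  refine clm_eq_zero_of_monomial_zero_one hX hl (ext_extend (hgz.trans hz0.symm))
    (ext_extend fun z hz => ?_)
  have h := hrel hz
  have h0 : (X (monomial 0)).extend z = 0 := hgz hz
  simp only [h0] at h
  rw [hz0 hz]
  simpa using h

/-- With `φ(z) = z² + z` and `U` the open unit disc, the set of extended eigenvalues of the analytic
Toeplitz operator `T_φ` on `H²` is `{1} ∪ (ℂ \ (-4 φ(U)))`. -/
theorem proposition7p1 :
    extendedEigenvalues
        (HardySpace.toeplitz (fun z : ℂ => z ^ 2 + z) isBoundedAnalytic_sq_add_self) =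
      {1} ∪ {l : ℂ | ∃ z ∈ Metric.ball (0 : ℂ) 1, l = -4 * (z ^ 2 + z)}ᶜ := by
  ext l
  constructor
  · intro hl
    by_contra hcon
    rw [Set.mem_union, not_or, Set.notMem_compl_iff] at hcon
    obtain ⟨h1, w, hw, hlw⟩ := hcon
    exact h1 (eq_one_of_mem_extendedEigenvalues hl hw hlw)
  · rintro (rfl | hl)
    · refine ⟨ContinuousLinearMap.id ℂ _, fun h => ?_, by ext; simp⟩
      have h := congrArg (fun Y : HardySpace →L[ℂ] HardySpace => ‖Y (HardySpace.monomial 0)‖) h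
      simp [HardySpace.norm_monomial] at h
    · refine mem_extendedEigenvalues_of_roots fun z hz => ?_
      by_contra! hlt
      exact hl ⟨z, mem_ball_zero_iff.2 hlt, by linear_combination 4 * hz⟩
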